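/- Let $(a_n)_{n\ge 1}$ be a sequence of integers such that, for some $\eta>0$, $$\frac{a_{n+1}}{a_n}\ \ge\ 1+\frac{1}{(\log\log\log n)^{1-\eta}}$$ for all sufficiently large $n$ (in particular $a_n\ne 0$ for these $n$). Then $(a_n)$ is strong sweeping out for the logarithmic averages $\frac{1}{\log N}\sum_{n\le N}\frac1n f(T^{a_n}x)$, which means the following. Let $(X,\Sigma,\mu)$ be a probability space and let $T:X\to X$ be an aperiodic measure preserving transformation, where $T$ is assumed to be invertible (with measurable inverse) unless $a_n\ge 0$ for all $n \ge 1$. Then for every $\epsilon>0$ there is a set $E\in\Sigma$ with $\mu(E)<\epsilon$ such that for $\mu$-almost every $x\in X$ $$\limsup_{N\to\infty}\frac{1}{\log N}\sum_{n=1}^{N}\frac1n \mathbf 1_E(T^{a_n}x)=1\qquad\text{and}\qquad \liminf_{N\to\infty}\frac{1}{\log N}\sum_{n=1}^{N}\frac1n \mathbf 1_E(T^{a_n}x)=0.$$ Here $T$ is called aperiodic if for every $n\ge1$ there is no set $A\in\Sigma$ of positive measure with $\mu(B\,\triangle\,T^{-n}B)=0$ for all $B\in\Sigma$, $B\subseteq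 A$; on a standard Borel probability space this means that almost every point of $X$ is non-periodic for $T$. -/

import Mathlib

open MeasureTheory Filter

universe u

namespace LogSweep

/-- A measure preserving transformation `T` is aperiodic if for no `n ≥ 1` there is a measurable set
`A` of positive measure on which `T^n` acts, modulo null sets, as the identity, that is, such that
`T^{-n} B = B` modulo null sets for all measurable `B ⊆ A`. On a standard Borel space this says
that almost every point is non-periodic (see `isAperiodic_iff` below). -/
def IsAperiodic {X : Type*} [MeasurableSpace X] (μ : Measure X) (T : X → X) : Prop :=
  ∀ n : ℕ, 1 ≤ n → ∀ A : Set X, MeasurableSet A → 0 < μ A →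
    ∃ B : Set X, MeasurableSet B ∧ B ⊆ A ∧ 0 < μ (symmDiff B (T^[n] ⁻¹' B))

/-- On a standard Borel probability space, `T` is aperiodic if and only if almost every point is
not a periodic point of `T`. -/
theorem isAperiodic_iff {X : Type*} [MeasurableSpace X] [StandardBorelSpace X]
    {μ : Measure X} [IsProbabilityMeasure μ] {T : X → X} (hT : MeasurePreserving T μ μ) :
    IsAperiodic μ T ↔ ∀ᵐ x ∂μ, ∀ n : ℕ, 1 ≤ n → T^[n] x ≠ x := by
  constructor
  · intro h
    rw [ae_all_iff]
    intro n
    by_cases hn : 1 ≤ n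
    swap
    · exact Eventually.of_forall fun x hx => absurd hx hn
    have hTn : MeasurePreserving (T^[n]) μ μ := hT.iterate n
    have hP : MeasurableSet {x | T^[n] x = x} :=
      measurableSet_eq_fun hTn.measurable measurable_id
    have h0 : μ {x | T^[n] x = x} = 0 := by
      by_contra hne
      obtain ⟨B, hB, hBA, hpos⟩ := h n hn _ hP (pos_iff_ne_zero.mpr hne)
      have hsub : B ⊆ T^[n] ⁻¹' B := by
        intro x hx
        have hx' : T^[n] x = x := hBA hx
        simpa [Set.mem_preimage, hx'] using hx
      have hBn : MeasurableSet (T^[n] ⁻¹' B) := hTn.measurable hB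
      have : μ (symmDiff B (T^[n] ⁻¹' B)) = 0 := by
        rw [Set.symmDiff_def, Set.sdiff_eq_empty.mpr hsub, Set.empty_union,
          measure_sdiff hsub hB.nullMeasurableSet (measure_ne_top μ B),
          hTn.measure_preimage hB.nullMeasurableSet, tsub_self]
      exact hpos.ne' this
    have : ∀ᵐ x ∂μ, ¬ (T^[n] x = x) := measure_eq_zero_iff_ae_notMem.mp h0
    filter_upwards [this] with x hx _ using hx
  · intro h n hn A hA hpos
    by_contra! hcon
    obtain ⟨U, hU, hsep⟩ := exists_seq_separating X MeasurableSet.empty Set.univ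
    have key : ∀ B : Set X, MeasurableSet B → B ⊆ A → ∀ᵐ x ∂μ, x ∈ B → T^[n] x ∈ B := by
      intro B hB hBA
      have h0 : μ (symmDiff B (T^[n] ⁻¹' B)) = 0 := le_antisymm (hcon B hB hBA) zero_le
      filter_upwards [measure_eq_zero_iff_ae_notMem.mp h0] with x hx hxB
      by_contra hxn
      exact hx (Or.inl ⟨hxB, hxn⟩)
    have h1 : ∀ᵐ x ∂μ, ∀ i, x ∈ A ∩ U i → T^[n] x ∈ A ∩ U i :=
      ae_all_iff.mpr fun i => key _ (hA.inter (hU i)) Set.inter_subset_left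
    have h2 : ∀ᵐ x ∂μ, ∀ i, x ∈ A \ U i → T^[n] x ∈ A \ U i :=
      ae_all_iff.mpr fun i => key _ (hA.diff (hU i)) Set.sdiff_subset
    refine hpos.ne' (measure_eq_zero_iff_ae_notMem.mpr ?_)
    filter_upwards [h, h1, h2] with x hx hx1 hx2 hxA
    refine hx n hn (hsep _ (Set.mem_univ _) _ (Set.mem_univ _) fun i => ⟨fun hi => ?_, fun hi => ?_⟩)
    · by_contra hxi
      exact (hx2 i ⟨hxA, hxi⟩).2 hi
    · exact (hx1 i ⟨hxA, hi⟩).2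

/-- The logarithmic average `(1 / log N) * ∑_{n = 1}^{N} (1 / n) * 1_E (S_n x)` of the indicator
function of `E` along a sequence `S_1, S_2, …` of self-maps of `X`, at the point `x`. -/
noncomputable def logAverage {X : Type*} (S : ℕ → X → X) (E : Set X) (x : X) (N : ℕ) : ℝ :=
  1 / Real.log N * ∑ n ∈ Finset.Icc 1 N, 1 / (n : ℝ) * E.indicator (fun _ => (1 : ℝ)) (S n x)

/-- The sequence of maps `S_1, S_2, …` sweeps out for the logarithmic averages: there are sets `E`
of arbitrarily small measure such that almost everywhere the logarithmic averages of the indicator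
of `E` have `limsup` equal to `1` and `liminf` equal to `0`. -/
def SweepsOut {X : Type*} [MeasurableSpace X] (μ : Measure X) (S : ℕ → X → X) : Prop :=
  ∀ ε : ℝ, 0 < ε → ∃ E : Set X, MeasurableSet E ∧ μ E < ENNReal.ofReal ε ∧
    ∀ᵐ x ∂μ, limsup (fun N : ℕ => logAverage S E x N) atTop = 1 ∧
      liminf (fun N : ℕ => logAverage S E x N) atTop = 0

/-- The sequence of integers `a_1, a_2, …` is strong sweeping out for the logarithmic averages:
`T^{a_1}, T^{a_2}, …` sweep out for every aperiodic measure preserving transformation `T` of a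
probability space for which the powers make sense. These are all invertible `T`, and also the
possibly non-invertible `T` if no `a_n` is negative. The value `a 0` plays no role. -/
def StrongSweepingOut (a : ℕ → ℤ) : Prop :=
  (∀ (X : Type u) [MeasurableSpace X] (μ : Measure X) [IsProbabilityMeasure μ] (T : X ≃ᵐ X),
    MeasurePreserving T μ μ → IsAperiodic μ T →
      SweepsOut μ (fun n x => ((T.toEquiv : Equiv.Perm X) ^ a n) x)) ∧
  ((∀ n : ℕ, 1 ≤ n → 0 ≤ a n) →
    ∀ (X : Type u) [MeasurableSpace X] (μ : Measure X) [IsProbabilityMeasure μ] (T : X → X),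
      MeasurePreserving T μ μ → IsAperiodic μ T → SweepsOut μ (fun n x => T^[(a n).toNat] x))

end LogSweep

/-! By the growth condition, `D` consecutive steps multiply `|a n|` by at least `2 * K` on a long
range of `n`, so each residue class modulo `D` is lacunary there. Nested intervals give one
frequency `θ d` per class that steers `a n * θ d` modulo 1 to arbitrary targets within `1 / K`. The
range is cut into `K ^ D` windows, one for each vector of `D` targets in `{0, …, K - 1}`. Hence for
every integer `i` some window suits the position of all `i * θ d`, and throughout it `i - a n` lies
in a fixed integer set of density at most `2 * D / K` (`exists_frequencies_windows`,
`exists_integer_pattern`).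

The windows must be long logarithmically, so each endpoint is a fixed power of the previous one, and
the triple logarithm of the last is about `D * log K`. With `K = 4 ^ t` and `D = 2 ^ t * (2 * t +
1)` this is of order `t ^ 2 * 2 ^ t`; its power `1 - η` is below `2 ^ t`, so the ratios are still at
least `1 + 2 ^ (-t)`, as required, while `D / K` tends to 0 (`exists_log_windows`).

A tall Rokhlin tower turns the integer set into a small set `F` in which almost all points spend a
whole window (`IsAperiodic.sweepsOut`). Gluing such sets at rapidly separated scales, alternately
inside and outside `E`, gives limsup 1 and liminf 0 (`sweepsOut_of_windows`). -/

namespace LogSweep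

open scoped ENNReal

/-! ### Rokhlin towers for aperiodic transformations -/

section Rokhlin

variable {X : Type*} {T : X → X}

/-- The set of points whose forward orbit under `T` meets `A`. -/
def sweep (T : X → X) (A : Set X) : Set X := ⋃ i : ℕ, T^[i] ⁻¹' A

theorem mem_sweep {A : Set X} {x : X} : x ∈ sweep T A ↔ ∃ i, T^[i] x ∈ A := by
  simp [sweep]

theorem subset_sweep (A : Set X) : A ⊆ sweep T A :=
  fun _ hx => mem_sweep.2 ⟨0, hx⟩

theorem sweep_mono : Monotone (sweep T) :=
  fun _ _ h => Set.iUnion_mono fun _ => Set.preimage_mono h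

theorem sweep_union (A B : Set X) : sweep T (A ∪ B) = sweep T A ∪ sweep T B := by
  ext x
  simp only [mem_sweep, Set.mem_union, exists_or]

theorem pairwise_disjoint_preimage_iterate {B : Set X} {n : ℕ}
    (h : ∀ k, 1 ≤ k → k < n → Disjoint B (T^[k] ⁻¹' B)) :
    (Set.Iio n).PairwiseDisjoint (fun i => T^[i] ⁻¹' B) := by
  have key : ∀ i j, i < j → j < n → Disjoint (T^[i] ⁻¹' B) (T^[j] ⁻¹' B) := by
    intro i j hij hj
    rw [Set.disjoint_left]
    intro x hx hx'
    refine Set.disjoint_left.1 (h (j - i) (by omega) (by omega)) hx ?_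
    rw [Set.mem_preimage, ← Function.iterate_add_apply]
    rwa [Nat.sub_add_cancel hij.le]
  intro i hi j hj hij
  rcases lt_or_gt_of_ne hij with h' | h'
  · exact key i j h' hj
  · exact (key j i h' hi).symm

/-- Exhaustion: step `j` picks an extension within `1 / (j + 1)` of the supremum over all
extensions, and the union of the resulting chain is maximal. -/
theorem exists_maximal_of_iUnion_closed {p : Set X → Prop} {f : Set X → ℝ≥0∞} (hf : Monotone f)
    (hf1 : ∀ A, f A ≤ 1) (h0 : p ∅)
    (hU : ∀ A : ℕ → Set X, Monotone A → (∀ j, p (A j)) → p (⋃ j, A j)) :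
    ∃ A, p A ∧ ∀ B, p B → A ⊆ B → f B ≤ f A := by
  have step : ∀ (j : ℕ) (A : Set X), p A → ∃ B, p B ∧ A ⊆ B ∧
      ∀ C, p C → A ⊆ C → f C ≤ f B + ((j : ℝ≥0∞) + 1)⁻¹ := by
    intro j A hA
    set s : ℝ≥0∞ := sSup (f '' {C | p C ∧ A ⊆ C}) with hs
    have hle : ∀ C, p C → A ⊆ C → f C ≤ s := fun C hC hAC => le_sSup ⟨C, ⟨hC, hAC⟩, rfl⟩
    have hs1 : s ≤ 1 := sSup_le (by rintro _ ⟨C, _, rfl⟩; exact hf1 C)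
    rcases eq_or_ne s 0 with h | h
    · exact ⟨A, hA, subset_rfl, fun C hC hAC => (hle C hC hAC).trans (by simp [h])⟩
    · have hlt : s - ((j : ℝ≥0∞) + 1)⁻¹ < s :=
        ENNReal.sub_lt_self (hs1.trans_lt ENNReal.one_lt_top).ne h (by simp)
      obtain ⟨_, ⟨B, ⟨hB, hAB⟩, rfl⟩, hB'⟩ := lt_sSup_iff.1 hlt
      exact ⟨B, hB, hAB, fun C hC hAC => (hle C hC hAC).trans (tsub_le_iff_right.1 hB'.le)⟩
  choose! g hgp hgs hgm using step
  let A : ℕ → Set X := fun n => Nat.rec ∅ (fun j A => g j A) n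
  have hA : ∀ j, p (A j) := by
    intro j
    induction j with
    | zero => exact h0
    | succ j ih => exact hgp j _ ih
  have hmono : Monotone A := monotone_nat_of_le_succ fun j => hgs j _ (hA j)
  refine ⟨⋃ j, A j, hU A hmono hA, fun B hB hAB => ?_⟩
  have hlim : Tendsto (fun j : ℕ => f (⋃ j, A j) + ((j : ℝ≥0∞) + 1)⁻¹) atTop
      (nhds (f (⋃ j, A j) + 0)) := by
    refine tendsto_const_nhds.add ?_
    have := (tendsto_add_atTop_iff_nat 1).2 ENNReal.tendsto_inv_nat_nhds_zero
    simpa using this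
  rw [add_zero] at hlim
  refine ge_of_tendsto' hlim fun j => ?_
  refine (hgm j (A j) (hA j) B hB ((Set.subset_iUnion A j).trans hAB)).trans ?_
  gcongr
  exact hf (Set.subset_iUnion A (j + 1))

variable [MeasurableSpace X] {μ : Measure X}

/-- At each step aperiodicity gives a `C` that differs from `T^{-(n+1)} C`. Both differences have
the same measure, so removing the preimage from `C` leaves positive measure. -/
theorem IsAperiodic.exists_subset_disjoint [IsProbabilityMeasure μ] (hap : IsAperiodic μ T)
    (hT : MeasurePreserving T μ μ) {A : Set X} (hA : MeasurableSet A) (hpos : 0 < μ A) (n : ℕ) :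
    ∃ B ⊆ A, MeasurableSet B ∧ 0 < μ B ∧
      ∀ k, 1 ≤ k → k ≤ n → Disjoint B (T^[k] ⁻¹' B) := by
  induction n with
  | zero => exact ⟨A, subset_rfl, hA, hpos, fun k h1 h2 => absurd h2 (by omega)⟩
  | succ n ih =>
    obtain ⟨B, hBA, hB, hBpos, hdisj⟩ := ih
    obtain ⟨C, hC, hCB, hCpos⟩ := hap (n + 1) (by omega) B hB hBpos
    have hmp := hT.iterate (n + 1)
    have hC' : MeasurableSet (T^[n + 1] ⁻¹' C) := hmp.measurable hC
    refine ⟨C \ T^[n + 1] ⁻¹' C, Set.sdiff_subset.trans (hCB.trans hBA), hC.diff hC', ?_, ?_⟩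
    · rw [measure_symmDiff_eq hC.nullMeasurableSet hC'.nullMeasurableSet] at hCpos
      have heq : μ (C \ T^[n + 1] ⁻¹' C) = μ (T^[n + 1] ⁻¹' C \ C) :=
        measure_sdiff_symm hC.nullMeasurableSet hC'.nullMeasurableSet
        (hmp.measure_preimage hC.nullMeasurableSet).symm (measure_ne_top _ _)
      rw [← heq] at hCpos
      exact pos_iff_ne_zero.2 fun h0 => hCpos.ne' (by rw [h0, add_zero])
    · intro k h1 h2
      rcases Nat.lt_or_ge k (n + 1) with hk | hk
      · refine (hdisj k h1 (by omega)).mono (Set.sdiff_subset.trans hCB) ?_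
        exact Set.preimage_mono (Set.sdiff_subset.trans hCB)
      · obtain rfl : k = n + 1 := by omega
        rw [Set.disjoint_left]
        exact fun x hx hx' => hx.2 hx'.1

theorem measurableSet_sweep (hT : Measurable T) {A : Set X} (hA : MeasurableSet A) :
    MeasurableSet (sweep T A) :=
  MeasurableSet.iUnion fun i => (hT.iterate i) hA

/-- The sweep of `A` contains its preimages, which have equal measure; so almost no orbit starting
in it ever leaves it. -/
theorem measure_sweep_inter_sweep_eq_zero [IsFiniteMeasure μ] (hT : MeasurePreserving T μ μ)
    {A B : Set X} (hA : MeasurableSet A) (hBA : B ⊆ (sweep T A)ᶜ) :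
    μ (sweep T A ∩ sweep T B) = 0 := by
  have hs := measurableSet_sweep hT.measurable hA
  have h1 (i : ℕ) : μ (sweep T A \ T^[i] ⁻¹' sweep T A) = 0 := by
    have hsub : T^[i] ⁻¹' sweep T A ⊆ sweep T A := by
      intro x hx
      obtain ⟨j, hj⟩ := mem_sweep.1 hx
      exact mem_sweep.2 ⟨j + i, by rwa [Function.iterate_add_apply]⟩
    rw [measure_sdiff hsub ((hT.iterate i).measurable hs).nullMeasurableSet (measure_ne_top _ _),
      (hT.iterate i).measure_preimage hs.nullMeasurableSet, tsub_self]
  refine measure_mono_null ?_ (measure_iUnion_null h1)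
  rintro x ⟨hxA, hxB⟩
  obtain ⟨i, hi⟩ := mem_sweep.1 hxB
  exact Set.mem_iUnion.2 ⟨i, hxA, hBA hi⟩

theorem measure_biUnion_preimage_iterate (hT : MeasurePreserving T μ μ) {B : Set X}
    (hB : MeasurableSet B) {n : ℕ} (h : (Set.Iio n).PairwiseDisjoint (fun i => T^[i] ⁻¹' B))
    (s : Finset ℕ) (hs : ∀ i ∈ s, i < n) :
    μ (⋃ i ∈ s, T^[i] ⁻¹' B) = s.card * μ B := by
  rw [measure_biUnion_finset (h.subset fun i hi => hs i hi)
    (fun i _ => (hT.iterate i).measurable hB)]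
  simp [(hT.iterate _).measure_preimage hB.nullMeasurableSet]

/-- Take `A` with maximal sweep among the sets obeying `n * μ A ≤ μ (sweep T A)`. If the sweep
missed positive measure, a set `B` there with `n` disjoint preimages could be added to `A`. -/
theorem IsAperiodic.exists_small_sweep [IsProbabilityMeasure μ] (hap : IsAperiodic μ T)
    (hT : MeasurePreserving T μ μ) (n : ℕ) :
    ∃ A, MeasurableSet A ∧ (n : ℝ≥0∞) * μ A ≤ 1 ∧ μ (sweep T A)ᶜ = 0 := by
  obtain ⟨A, ⟨hA, hAn⟩, hmax⟩ := exists_maximal_of_iUnion_closed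
    (p := fun A => MeasurableSet A ∧ (n : ℝ≥0∞) * μ A ≤ μ (sweep T A))
    (f := fun A => μ (sweep T A)) (fun A B h => measure_mono (sweep_mono h))
    (fun A => prob_le_one) (by simp)
    (by
      intro A hmono hA
      refine ⟨MeasurableSet.iUnion fun j => (hA j).1, ?_⟩
      rw [hmono.measure_iUnion, ENNReal.mul_iSup]
      refine iSup_le fun j => (hA j).2.trans (measure_mono (sweep_mono (Set.subset_iUnion A j))))
  refine ⟨A, hA, hAn.trans prob_le_one, ?_⟩
  by_contra hne
  have hs := measurableSet_sweep hT.measurable hA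
  obtain ⟨B, hBA, hB, hBpos, hdisj⟩ :=
    hap.exists_subset_disjoint hT hs.compl (pos_iff_ne_zero.2 hne) n
  have hBn : (n : ℝ≥0∞) * μ B ≤ μ (sweep T B) := by
    have := measure_biUnion_preimage_iterate hT hB (n := n)
      (pairwise_disjoint_preimage_iterate fun k h1 h2 => hdisj k h1 h2.le) (Finset.range n)
      (by simp)
    rw [Finset.card_range] at this
    rw [← this]
    exact measure_mono (Set.iUnion₂_subset fun i _ => Set.subset_iUnion (fun i => T^[i] ⁻¹' B) i)
  have hunion : μ (sweep T (A ∪ B)) = μ (sweep T A) + μ (sweep T B) := by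
    rw [sweep_union]
    exact measure_union₀ (measurableSet_sweep hT.measurable hB).nullMeasurableSet
      (measure_sweep_inter_sweep_eq_zero hT hA hBA)
  have h1 := hmax (A ∪ B) ⟨hA.union hB, by
    rw [hunion]
    calc (n : ℝ≥0∞) * μ (A ∪ B) ≤ n * (μ A + μ B) := by gcongr; exact measure_union_le _ _
      _ ≤ _ := by rw [mul_add]; gcongr⟩ Set.subset_union_left
  simp only [hunion] at h1
  have h2 : 0 < μ (sweep T B) := hBpos.trans_le (measure_mono (subset_sweep B))
  exact (ENNReal.lt_add_right (measure_ne_top _ _) h2.ne').not_ge h1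

/-- **Rokhlin's lemma** for aperiodic, not necessarily invertible, transformations. -/
theorem IsAperiodic.exists_rokhlin_tower [IsProbabilityMeasure μ] (hap : IsAperiodic μ T)
    (hT : MeasurePreserving T μ μ) {n : ℕ} (hn : 0 < n) {δ : ℝ≥0∞} (hδ : δ ≠ 0) :
    ∃ B, MeasurableSet B ∧ (Set.Iio n).PairwiseDisjoint (fun i => T^[i] ⁻¹' B) ∧
      μ (⋃ i ∈ Finset.range n, T^[i] ⁻¹' B)ᶜ ≤ δ := by
  classical
  obtain ⟨m, hm⟩ := ENNReal.exists_nat_mul_gt hδ (b := n) (ENNReal.natCast_ne_top n)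
  obtain ⟨A, hA, hAm, hAs⟩ := hap.exists_small_sweep hT m
  -- `L r` is the set of points that first hit `A` at time `r`. While positive, this time drops by
  -- one under `T`.
  let L : ℕ → Set X := fun r => T^[r] ⁻¹' A \ ⋃ i ∈ Finset.range r, T^[i] ⁻¹' A
  have hL : ∀ r, MeasurableSet (L r) := fun r =>
    ((hT.iterate r).measurable hA).diff
      (Finset.measurableSet_biUnion _ fun i _ => (hT.iterate i).measurable hA)
  have mem_L : ∀ {r x}, x ∈ L r ↔ T^[r] x ∈ A ∧ ∀ i < r, T^[i] x ∉ A := by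
    intro r x
    simp [L]
  have L_unique : ∀ {r r' x}, x ∈ L r → x ∈ L r' → r = r' := by
    intro r r' x h h'
    rw [mem_L] at h h'
    rcases lt_trichotomy r r' with hlt | rfl | hlt
    · exact absurd h.1 (h'.2 r hlt)
    · rfl
    · exact absurd h'.1 (h.2 r' hlt)
  have L_shift : ∀ {r i x}, i ≤ r → x ∈ L r → T^[i] x ∈ L (r - i) := by
    intro r i x hi h
    rw [mem_L] at h ⊢
    simp only [← Function.iterate_add_apply]
    exact ⟨by rw [Nat.sub_add_cancel hi]; exact h.1, fun k hk => h.2 _ (by omega)⟩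
  -- The base consists of the points whose hitting time is a positive multiple of `n`. The tower
  -- misses only points that never hit `A` or hit it before time `n`.
  refine ⟨⋃ q, L ((q + 1) * n), MeasurableSet.iUnion fun q => hL _,
    pairwise_disjoint_preimage_iterate ?_, ?_⟩
  · intro k h1 h2
    rw [Set.disjoint_left]
    intro x hx hx'
    obtain ⟨q, hq⟩ := Set.mem_iUnion.1 hx
    obtain ⟨q', hq'⟩ := Set.mem_iUnion.1 hx'
    have hkq : k ≤ (q + 1) * n := by nlinarith
    have := L_unique (L_shift hkq hq) hq'
    have h3 : (q + 1) * n = (q' + 1) * n + k := by omega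
    have h4 : n ∣ k := (Nat.dvd_add_right (Dvd.intro_left _ rfl)).1 (h3 ▸ Dvd.intro_left _ rfl)
    exact absurd (Nat.le_of_dvd (by omega) h4) (by omega)
  · have hsub : (⋃ i ∈ Finset.range n, T^[i] ⁻¹' ⋃ q, L ((q + 1) * n))ᶜ ⊆
        (sweep T A)ᶜ ∪ ⋃ i ∈ Finset.range n, T^[i] ⁻¹' A := by
      intro x hx
      by_contra hcon
      simp only [Set.mem_union, Set.mem_compl_iff, not_or, not_not, Set.mem_iUnion,
        Finset.mem_range, Set.mem_preimage, not_exists] at hcon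
      obtain ⟨hxs, hxn⟩ := hcon
      rw [mem_sweep] at hxs
      have hr : x ∈ L (Nat.find hxs) := mem_L.2 ⟨Nat.find_spec hxs, fun i hi => Nat.find_min hxs hi⟩
      set r := Nat.find hxs
      have hrn : n ≤ r := by
        by_contra hlt
        exact hxn r (by omega) (Nat.find_spec hxs)
      refine hx ?_
      simp only [Set.mem_iUnion, Finset.mem_range, Set.mem_preimage]
      have hq : 1 ≤ r / n := (Nat.one_le_div_iff hn).2 hrn
      refine ⟨r % n, Nat.mod_lt _ hn, r / n - 1, ?_⟩
      have := L_shift (Nat.mod_le r n) hr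
      rwa [Nat.sub_add_cancel hq, Nat.div_mul_self_eq_mod_sub_self]
    refine (measure_mono hsub).trans ((measure_union_le _ _).trans ?_)
    rw [hAs, zero_add]
    calc μ (⋃ i ∈ Finset.range n, T^[i] ⁻¹' A) ≤ ∑ i ∈ Finset.range n, μ (T^[i] ⁻¹' A) :=
          measure_biUnion_finset_le _ _
      _ = n * μ A := by simp [(hT.iterate _).measure_preimage hA.nullMeasurableSet]
      _ ≤ (m * δ) * μ A := by gcongr
      _ = δ * (m * μ A) := by ring
      _ ≤ δ * 1 := by gcongr
      _ = δ := mul_one δ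

end Rokhlin

/-! ### From log-windows to sweeping out -/

section Abstract

variable {X : Type*}

theorem sum_one_div_le (N : ℕ) : ∑ n ∈ Finset.Icc 1 N, 1 / (n : ℝ) ≤ 1 + Real.log N := by
  have := harmonic_le_one_add_log N
  rw [harmonic_eq_sum_Icc] at this
  push_cast at this
  simpa using this

theorem le_sum_one_div (N : ℕ) : Real.log (N + 1 : ℕ) ≤ ∑ n ∈ Finset.Icc 1 N, 1 / (n : ℝ) := by
  have := log_add_one_le_harmonic N
  rw [harmonic_eq_sum_Icc] at this
  push_cast at this
  simpa using this

theorem logAverage_nonneg (S : ℕ → X → X) (E : Set X) (x : X) (N : ℕ) :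
    0 ≤ logAverage S E x N := by
  refine mul_nonneg (one_div_nonneg.2 (Real.log_natCast_nonneg N)) (Finset.sum_nonneg fun n _ => ?_)
  exact mul_nonneg (by positivity) (Set.indicator_nonneg (fun _ _ => zero_le_one) _)

theorem logAverage_add_compl (S : ℕ → X → X) (E : Set X) (x : X) (N : ℕ) :
    logAverage S E x N + logAverage S Eᶜ x N =
      1 / Real.log N * ∑ n ∈ Finset.Icc 1 N, 1 / (n : ℝ) := by
  rw [logAverage, logAverage, ← mul_add, ← Finset.sum_add_distrib]
  congr 1
  refine Finset.sum_congr rfl fun n _ => ?_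
  rw [← mul_add, ← Pi.add_apply, Set.indicator_self_add_compl, mul_one]

theorem logAverage_le (S : ℕ → X → X) (E : Set X) (x : X) (N : ℕ) :
    logAverage S E x N ≤ 1 / Real.log N * (1 + Real.log N) := by
  have h1 := logAverage_add_compl S E x N
  have h2 := logAverage_nonneg S Eᶜ x N
  have h3 : 1 / Real.log N * ∑ n ∈ Finset.Icc 1 N, 1 / (n : ℝ) ≤
      1 / Real.log N * (1 + Real.log N) :=
    mul_le_mul_of_nonneg_left (sum_one_div_le N) (one_div_nonneg.2 (Real.log_natCast_nonneg N))
  linarith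

theorem logAverage_le_of_forall_notMem {S : ℕ → X → X} {E : Set X} {x : X} {P N : ℕ}
    (h : ∀ n ∈ Finset.Ioc P N, S n x ∉ E) :
    logAverage S E x N ≤ 1 / Real.log N * (1 + Real.log P) := by
  refine mul_le_mul_of_nonneg_left ?_ (one_div_nonneg.2 (Real.log_natCast_nonneg N))
  refine le_trans ?_ (sum_one_div_le P)
  calc ∑ n ∈ Finset.Icc 1 N, 1 / (n : ℝ) * E.indicator (fun _ => (1 : ℝ)) (S n x)
      ≤ ∑ n ∈ Finset.Icc 1 N, if n ≤ P then 1 / (n : ℝ) else 0 := by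
        refine Finset.sum_le_sum fun n hn => ?_
        split_ifs with hP
        · refine mul_le_of_le_one_right (by positivity) ?_
          exact Set.indicator_le_self' (fun _ _ => zero_le_one) _
        · rw [Set.indicator_of_notMem, mul_zero]
          exact h n (Finset.mem_Ioc.2 ⟨by omega, (Finset.mem_Icc.1 hn).2⟩)
    _ = ∑ n ∈ (Finset.Icc 1 N).filter (· ≤ P), 1 / (n : ℝ) := (Finset.sum_filter _ _).symm
    _ ≤ _ := by
        refine Finset.sum_le_sum_of_subset_of_nonneg ?_ fun _ _ _ => by positivity
        intro n hn
        simp only [Finset.mem_filter, Finset.mem_Icc] at hn ⊢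
        omega

theorem tendsto_inv_log : Tendsto (fun N : ℕ => 1 / Real.log N) atTop (nhds 0) := by
  simp only [one_div]
  exact (Real.tendsto_log_atTop.comp tendsto_natCast_atTop_atTop).inv_tendsto_atTop

theorem isBoundedUnder_logAverage (S : ℕ → X → X) (E : Set X) (x : X) :
    IsBoundedUnder (· ≤ ·) atTop (logAverage S E x) ∧
      IsBoundedUnder (· ≥ ·) atTop (logAverage S E x) := by
  refine ⟨?_, isBoundedUnder_of ⟨0, logAverage_nonneg S E x⟩⟩
  have h : Tendsto (fun N : ℕ => 1 / Real.log N * (1 + Real.log N)) atTop (nhds (0 + 1)) := by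
    refine (tendsto_inv_log.add_const 1).congr' ?_
    filter_upwards [eventually_ge_atTop 2] with N hN
    have : Real.log N ≠ 0 := (Real.log_pos (by exact_mod_cast hN)).ne'
    field_simp
  exact h.isBoundedUnder_le.mono_le (Eventually.of_forall (logAverage_le S E x))

/-- The window `(P, N]` reaches far enough, on the logarithmic scale, to determine the logarithmic
average up to `N`, with an error governed by `δ`. -/
def IsLogWindow (δ : ℝ) (P N : ℕ) : Prop := Real.log P ≤ δ * Real.log N

/-- Only indices up to `P` contribute, and their weight is at most `(1 + log P) / log N`. -/
theorem liminf_logAverage_eq_zero {S : ℕ → X → X} {E : Set X} {x : X}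
    (h : ∀ δ > 0, ∀ m : ℕ, ∃ P N, m ≤ N ∧ IsLogWindow δ P N ∧ ∀ n ∈ Finset.Ioc P N, S n x ∉ E) :
    liminf (logAverage S E x) atTop = 0 := by
  obtain ⟨hb1, hb2⟩ := isBoundedUnder_logAverage S E x
  refine le_antisymm (le_of_forall_pos_le_add fun δ hδ => ?_)
    (le_liminf_of_le hb1.isCoboundedUnder_ge (Eventually.of_forall (logAverage_nonneg S E x)))
  refine liminf_le_of_frequently_le ?_ hb2
  rw [frequently_atTop]
  intro m
  obtain ⟨m', hm'⟩ := eventually_atTop.1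
    ((tendsto_inv_log.eventually (ge_mem_nhds (half_pos hδ))).and (eventually_ge_atTop 2))
  obtain ⟨P, N, hN, hw, hE⟩ := h (δ / 2) (half_pos hδ) (max m m')
  obtain ⟨h1, h2⟩ := hm' N (le_trans (le_max_right _ _) hN)
  refine ⟨N, le_trans (le_max_left _ _) hN, (logAverage_le_of_forall_notMem hE).trans ?_⟩
  have hlog : 0 < Real.log N := Real.log_pos (by exact_mod_cast h2)
  have : 1 / Real.log N * Real.log P ≤ δ / 2 := by
    rw [one_div_mul_eq_div, div_le_iff₀ hlog]
    exact hw
  linarith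

theorem limsup_logAverage_eq_one {S : ℕ → X → X} {E : Set X} {x : X}
    (h : ∀ δ > 0, ∀ m : ℕ, ∃ P N, m ≤ N ∧ IsLogWindow δ P N ∧ ∀ n ∈ Finset.Ioc P N, S n x ∈ E) :
    limsup (logAverage S E x) atTop = 1 := by
  obtain ⟨hb1, hb2⟩ := isBoundedUnder_logAverage S E x
  refine le_antisymm (le_of_forall_pos_le_add fun δ hδ => ?_)
    (le_of_forall_pos_sub_le fun δ hδ => ?_)
  · refine limsup_le_of_le hb2.isCoboundedUnder_le ?_
    filter_upwards [tendsto_inv_log.eventually (ge_mem_nhds hδ), eventually_ge_atTop 2] with N h1 h2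
    have hlog : Real.log N ≠ 0 := (Real.log_pos (by exact_mod_cast h2)).ne'
    refine (logAverage_le S E x N).trans ?_
    rw [mul_add, mul_one, one_div_mul_cancel hlog]
    linarith
  · refine le_limsup_of_frequently_le ?_ hb1
    have hl : ∃ᶠ N in atTop, logAverage S Eᶜ x N < δ := by
      have := liminf_logAverage_eq_zero (E := Eᶜ) (S := S) (x := x) (by simpa using h)
      refine frequently_lt_of_liminf_lt ?_ (this.trans_lt hδ)
      exact (isBoundedUnder_logAverage S Eᶜ x).1.isCoboundedUnder_ge
    refine (hl.and_eventually (eventually_ge_atTop 2)).mono ?_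
    rintro N ⟨h1, h2⟩
    have hlog : 0 < Real.log N := Real.log_pos (by exact_mod_cast h2)
    have h3 := logAverage_add_compl S E x N
    have h4 : 1 ≤ 1 / Real.log N * ∑ n ∈ Finset.Icc 1 N, 1 / (n : ℝ) := by
      rw [one_div_mul_eq_div, one_le_div hlog]
      refine le_trans ?_ (le_sum_one_div N)
      exact Real.log_le_log (by positivity) (by push_cast; linarith)
    linarith

/-- If every point off a small set spends an entire log-window in a small set `F`, at arbitrarily
late times, then the maps sweep out. -/
theorem sweepsOut_of_windows [MeasurableSpace X] {μ : Measure X} [IsProbabilityMeasure μ]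
    {S : ℕ → X → X} (hS : ∀ n, 1 ≤ n → MeasurePreserving (S n) μ μ)
    (h : ∀ δ : ℝ, 0 < δ → ∀ m : ℕ, ∃ (M : ℕ) (F : Set X), MeasurableSet F ∧
      μ F ≤ ENNReal.ofReal δ ∧
      μ {x | ¬ ∃ P N, m ≤ N ∧ N ≤ M ∧ IsLogWindow δ P N ∧ ∀ n ∈ Finset.Ioc P N, S n x ∈ F} ≤
        ENNReal.ofReal δ) :
    SweepsOut μ S := by
  intro ε hε
  choose! M F hF hFδ hbad using h
  -- `A (k + 1)` bounds the time horizon `M` of stage `k`. Tolerances of later stages are divided by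
  -- it, so that all later sets stay negligible after pulling back along every map used at stage
  -- `k`.
  obtain ⟨A, hAzero, hAsucc⟩ : ∃ A : ℕ → ℕ, A 0 = 1 ∧
      ∀ k, A (k + 1) = A k + M (ε * (1 / 2) ^ (k + 2) / (A k : ℝ)) k :=
    ⟨fun k => Nat.rec 1 (fun k r => r + M (ε * (1 / 2) ^ (k + 2) / (r : ℝ)) k) k, rfl, fun _ => rfl⟩
  let e : ℕ → ℝ := fun k => ε * (1 / 2) ^ (k + 2) / (A k : ℝ)
  have hAmono : Monotone A := monotone_nat_of_le_succ fun k => by rw [hAsucc]; omega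
  have hA1 : ∀ k, 1 ≤ A k := fun k => hAzero ▸ hAmono (Nat.zero_le k)
  have hA0 : ∀ k, (0 : ℝ) < A k := fun k => Nat.cast_pos.2 (hA1 k)
  have he : ∀ k, 0 < e k := fun k => by have := hA0 k; positivity
  have hele : ∀ k, e k ≤ ε * (1 / 2) ^ (k + 2) := fun k =>
    div_le_self (by positivity) (Nat.one_le_cast.2 (hA1 k))
  let G : ℕ → Set X := fun k => F (e k) k
  have hG : ∀ k, MeasurableSet (G k) := fun k => hF _ (he k) k
  have hGe : ∀ k, μ (G k) ≤ ENNReal.ofReal (e k) := fun k => hFδ _ (he k) k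
  let U : ℕ → Set X := fun k => ⋃ l, G (k + 1 + l)
  have hU : ∀ k, MeasurableSet (U k) := fun k => MeasurableSet.iUnion fun l => hG _
  have hsum : ∀ k : ℕ, HasSum (fun l : ℕ => ε * (1 / 2) ^ (k + l + 2)) (ε * (1 / 2) ^ (k + 1)) := by
    intro k
    have : HasSum (fun l : ℕ => ε * (1 / 2) ^ (k + 2) * (1 / 2) ^ l) (ε * (1 / 2) ^ (k + 2) * 2) :=
      hasSum_geometric_two.mul_left _
    convert this using 1
    · ext l; ring
    · ring
  have hUe : ∀ k, μ (U k) ≤ ENNReal.ofReal (ε * (1 / 2) ^ (k + 2) / A (k + 1)) := by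
    intro k
    have hs := (hsum (k + 1)).div_const (A (k + 1) : ℝ)
    calc μ (U k) ≤ ∑' l, μ (G (k + 1 + l)) := measure_iUnion_le _
      _ ≤ ∑' l, ENNReal.ofReal (ε * (1 / 2) ^ (k + 1 + l + 2) / A (k + 1)) := by
        refine ENNReal.tsum_le_tsum fun l => (hGe _).trans (ENNReal.ofReal_le_ofReal ?_)
        have : (A (k + 1) : ℝ) ≤ A (k + 1 + l) := by exact_mod_cast hAmono (by omega : k + 1 ≤ k + 1 + l)
        have := hA0 (k + 1)
        exact div_le_div_of_nonneg_left (by positivity) this ‹_›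
      _ = _ := by
        rw [← ENNReal.ofReal_tsum_of_nonneg (fun l => by have := hA0 (k + 1); positivity)
          hs.summable, hs.tsum_eq]
  -- A point belongs to `E` when the last `G k` containing it exists and has even index; so even
  -- stages give windows in `E`, odd stages windows off `E`.
  let E : Set X := ⋃ j, (G (2 * j) \ U (2 * j))
  have hGU_sub : ∀ j, G (2 * j) \ U (2 * j) ⊆ E := fun j =>
    Set.subset_iUnion (fun j => G (2 * j) \ U (2 * j)) j
  have hGU_disj : ∀ j y, y ∈ G (2 * j + 1) \ U (2 * j + 1) → y ∉ E := by
    intro j y hy hyE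
    obtain ⟨i, hi⟩ := Set.mem_iUnion.1 hyE
    rcases Nat.lt_or_ge (2 * j + 1) (2 * i) with hlt | hge
    · refine hy.2 (Set.mem_iUnion.2 ⟨2 * i - (2 * j + 2), ?_⟩)
      rw [show 2 * j + 1 + 1 + (2 * i - (2 * j + 2)) = 2 * i by omega]
      exact hi.1
    · refine hi.2 (Set.mem_iUnion.2 ⟨2 * j + 1 - (2 * i + 1), ?_⟩)
      rw [show 2 * i + 1 + (2 * j + 1 - (2 * i + 1)) = 2 * j + 1 by omega]
      exact hy.1
  -- Points without a good window at stage `k`, or carried into a later `G` within its horizon.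
  -- These measures are summable, so Borel–Cantelli applies.
  let Z : ℕ → Set X := fun k =>
    {x | ¬ ∃ P N, k ≤ N ∧ N ≤ M (e k) k ∧ IsLogWindow (e k) P N ∧
      ∀ n ∈ Finset.Ioc P N, S n x ∈ G k} ∪ ⋃ n ∈ Finset.Icc 1 (M (e k) k), S n ⁻¹' U k
  have hZ : ∀ k, μ (Z k) ≤ ENNReal.ofReal (ε * (1 / 2) ^ (k + 1)) := by
    intro k
    have h1 : μ (⋃ n ∈ Finset.Icc 1 (M (e k) k), S n ⁻¹' U k) ≤
        ENNReal.ofReal (ε * (1 / 2) ^ (k + 2)) := by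
      calc μ (⋃ n ∈ Finset.Icc 1 (M (e k) k), S n ⁻¹' U k)
          ≤ ∑ n ∈ Finset.Icc 1 (M (e k) k), μ (S n ⁻¹' U k) := measure_biUnion_finset_le _ _
        _ = ∑ n ∈ Finset.Icc 1 (M (e k) k), μ (U k) := Finset.sum_congr rfl fun n hn =>
            (hS n (Finset.mem_Icc.1 hn).1).measure_preimage (hU k).nullMeasurableSet
        _ = M (e k) k * μ (U k) := by simp
        _ ≤ (A (k + 1) : ℝ≥0∞) * ENNReal.ofReal (ε * (1 / 2) ^ (k + 2) / A (k + 1)) := by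
            gcongr
            · rw [hAsucc]; exact Nat.le_add_left _ _
            · exact hUe k
        _ = ENNReal.ofReal (ε * (1 / 2) ^ (k + 2)) := by
            rw [← ENNReal.ofReal_natCast, ← ENNReal.ofReal_mul (hA0 _).le,
              mul_div_cancel₀ _ (hA0 (k + 1)).ne']
    refine (measure_union_le _ _).trans ((add_le_add (hbad _ (he k) k) h1).trans ?_)
    rw [← ENNReal.ofReal_add (he k).le (by positivity)]
    refine ENNReal.ofReal_le_ofReal ((add_le_add_left (hele k) _).trans_eq ?_)
    ring
  have hZsum : ∑' k, μ (Z k) ≠ ∞ := by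
    refine ne_top_of_le_ne_top ?_ (ENNReal.tsum_le_tsum hZ)
    have hs : HasSum (fun k : ℕ => ε * (1 / 2) ^ (k + 1)) ε := by
      have : HasSum (fun l : ℕ => ε / 2 * (1 / 2) ^ l) (ε / 2 * 2) :=
        hasSum_geometric_two.mul_left _
      convert this using 1
      · ext l; ring
      · ring
    rw [← ENNReal.ofReal_tsum_of_nonneg (fun l => by positivity) hs.summable]
    exact ENNReal.ofReal_ne_top
  refine ⟨E, MeasurableSet.iUnion fun j => (hG _).diff (hU _), ?_, ?_⟩
  · have hsub : E ⊆ ⋃ k, G k :=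
      Set.iUnion_subset fun j => Set.sdiff_subset.trans (Set.subset_iUnion G (2 * j))
    have hs := hsum 0
    calc μ E ≤ ∑' k, μ (G k) := (measure_mono hsub).trans (measure_iUnion_le _)
      _ ≤ ∑' k : ℕ, ENNReal.ofReal (ε * (1 / 2) ^ (0 + k + 2)) :=
        ENNReal.tsum_le_tsum fun k => (hGe k).trans (ENNReal.ofReal_le_ofReal
          (by rw [zero_add]; exact hele k))
      _ = ENNReal.ofReal (ε * (1 / 2) ^ (0 + 1)) := by
        rw [← ENNReal.ofReal_tsum_of_nonneg (fun l => by positivity) hs.summable, hs.tsum_eq]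
      _ < ENNReal.ofReal ε := (ENNReal.ofReal_lt_ofReal_iff hε).2 (by linarith)
  · filter_upwards [ae_eventually_notMem hZsum] with x hx
    have hwin : ∀ δ > 0, ∀ m : ℕ, ∃ k₀, ∀ k ≥ k₀, ∃ P N, m ≤ N ∧ IsLogWindow δ P N ∧
        ∀ n ∈ Finset.Ioc P N, S n x ∈ G k \ U k := by
      intro δ hδ m
      have hlim : Tendsto (fun k : ℕ => ε * (1 / 2 : ℝ) ^ (k + 2)) atTop (nhds (ε * 0)) :=
        ((tendsto_add_atTop_iff_nat 2).2 (tendsto_pow_atTop_nhds_zero_of_lt_one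
          (by norm_num) (by norm_num))).const_mul ε
      rw [mul_zero] at hlim
      obtain ⟨k₀, hk₀⟩ := eventually_atTop.1
        (hx.and ((hlim.eventually (ge_mem_nhds hδ)).and (eventually_ge_atTop m)))
      refine ⟨k₀, fun k hk => ?_⟩
      obtain ⟨hxZ, hkδ, hkm⟩ := hk₀ k hk
      simp only [Z, Set.mem_union, not_or, Set.mem_ofPred_eq, not_not] at hxZ
      obtain ⟨⟨P, N, hkN, hNM, hw, hPN⟩, hxU⟩ := hxZ
      refine ⟨P, N, hkm.trans hkN, hw.trans ?_, fun n hn => ⟨hPN n hn, fun hnU => hxU ?_⟩⟩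
      · exact mul_le_mul_of_nonneg_right ((hele k).trans hkδ) (Real.log_natCast_nonneg N)
      · rw [Finset.mem_Ioc] at hn
        exact Set.mem_iUnion₂.2 ⟨n, Finset.mem_Icc.2 ⟨by omega, by omega⟩, hnU⟩
    refine ⟨limsup_logAverage_eq_one fun δ hδ m => ?_, liminf_logAverage_eq_zero fun δ hδ m => ?_⟩
    · obtain ⟨k₀, hk₀⟩ := hwin δ hδ m
      obtain ⟨P, N, h1, h2, h3⟩ := hk₀ (2 * k₀) (by omega)
      exact ⟨P, N, h1, h2, fun n hn => hGU_sub k₀ (h3 n hn)⟩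
    · obtain ⟨k₀, hk₀⟩ := hwin δ hδ m
      obtain ⟨P, N, h1, h2, h3⟩ := hk₀ (2 * k₀ + 1) (by omega)
      exact ⟨P, N, h1, h2, fun n hn => hGU_disj k₀ _ (h3 n hn)⟩

end Abstract

/-! ### Frequencies with prescribed fractional parts -/

section Diophantine

/-- `y` lies within `w` above an integer. -/
def NearInt (w y : ℝ) : Prop := ∃ z : ℤ, (z : ℝ) ≤ y ∧ y ≤ z + w

/-- The affine map stretches the interval to length at least 2, enough to contain a full `[z, z +
w]` with `z` an integer. -/
theorem exists_subinterval_nearInt {w b v u l : ℝ} (hw : w ≤ 1) (hb : b ≠ 0)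
    (hl : 2 ≤ |b| * l) :
    ∃ u', u ≤ u' ∧ u' + w / |b| ≤ u + l ∧
      ∀ θ, u' ≤ θ → θ ≤ u' + w / |b| → NearInt w (b * θ + v) := by
  have hb0 : 0 < |b| := abs_pos.2 hb
  rcases hb.lt_or_gt with hneg | hpos
  · rw [abs_of_neg hneg] at *
    refine ⟨((⌊b * u + v - w⌋ : ℝ) + w - v) / b, ?_, ?_, fun θ h1 h2 => ⟨⌊b * u + v - w⌋, ?_, ?_⟩⟩
    · rw [le_div_iff_of_neg hneg]
      linarith [Int.floor_le (b * u + v - w)]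
    · have h := Int.lt_floor_add_one (b * u + v - w)
      rw [div_neg, ← sub_eq_add_neg, ← sub_div, div_le_iff_of_neg hneg]
      nlinarith
    · rw [div_neg, ← sub_eq_add_neg, ← sub_div, le_div_iff_of_neg hneg] at h2
      linarith
    · rw [div_le_iff_of_neg hneg] at h1
      linarith
  · rw [abs_of_pos hpos] at *
    refine ⟨((⌈b * u + v⌉ : ℝ) - v) / b, ?_, ?_, fun θ h1 h2 => ⟨⌈b * u + v⌉, ?_, ?_⟩⟩
    · rw [le_div_iff₀ hpos]
      linarith [Int.le_ceil (b * u + v)]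
    · have h := Int.ceil_lt_add_one (b * u + v)
      rw [← add_div, div_le_iff₀ hpos]
      nlinarith
    · rw [div_le_iff₀ hpos] at h1
      linarith
    · rw [← add_div, le_div_iff₀ hpos] at h2
      linarith

/-- Nested intervals: the one found for `b n` has length `w / |b n|`, which `b (n + 1)` stretches to
length at least 2. -/
theorem exists_forall_nearInt {w : ℝ} (hw0 : 0 < w) (hw : w ≤ 1) {b : ℕ → ℝ} (v : ℕ → ℝ)
    (hb : b 0 ≠ 0) (n : ℕ) (hbn : ∀ i < n, 2 * |b i| ≤ w * |b (i + 1)|) :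
    ∃ θ, ∀ i ≤ n, NearInt w (b i * θ + v i) := by
  suffices H : ∃ u, b n ≠ 0 ∧
      ∀ θ, u ≤ θ → θ ≤ u + w / |b n| → ∀ i ≤ n, NearInt w (b i * θ + v i) by
    obtain ⟨u, _, hu⟩ := H
    exact ⟨u, hu u le_rfl (le_add_of_nonneg_right (by positivity))⟩
  induction n with
  | zero =>
    have hb0 : |b 0| ≠ 0 := abs_ne_zero.2 hb
    obtain ⟨u, _, _, hu⟩ := exists_subinterval_nearInt (v := v 0) (u := 0) (l := 2 / |b 0|) hw hb
      (by rw [mul_div_cancel₀ _ hb0])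
    refine ⟨u, hb, fun θ h1 h2 i hi => ?_⟩
    obtain rfl : i = 0 := by omega
    exact hu θ h1 h2
  | succ n ih =>
    obtain ⟨u, hbn0, hu⟩ := ih fun i hi => hbn i (by omega)
    have hpos : 0 < |b n| := abs_pos.2 hbn0
    have hr := hbn n (by omega)
    have hb' : b (n + 1) ≠ 0 := by
      intro h0
      rw [h0, abs_zero, mul_zero] at hr
      linarith
    obtain ⟨u', h1', h2', hu'⟩ := exists_subinterval_nearInt (v := v (n + 1)) (u := u)
      (l := w / |b n|) hw hb'
      (by rw [← mul_div_assoc, le_div_iff₀ hpos]; linarith)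
    refine ⟨u', hb', fun θ h1 h2 i hi => ?_⟩
    rcases Nat.lt_or_ge n i with h | h
    · obtain rfl : i = n + 1 := by omega
      exact hu' θ h1 h2
    · exact hu θ (by linarith) (by linarith) i h

/-- Along each residue class modulo `D` the sequence grows fast, so the fractional parts along each
class can be prescribed, with one frequency per class. -/
theorem exists_frequencies {w : ℝ} (hw0 : 0 < w) (hw : w ≤ 1) {b : ℕ → ℝ} (v : ℕ → ℝ)
    {D n₁ N : ℕ} (hD : 0 < D) (hb : ∀ n, n₁ ≤ n → b n ≠ 0)
    (hbn : ∀ n, n₁ ≤ n → n + D ≤ N → 2 * |b n| ≤ w * |b (n + D)|) :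
    ∃ θ : ℕ → ℝ, ∀ n, n₁ ≤ n → n ≤ N → NearInt w (b n * θ ((n - n₁) % D) + v n) := by
  have key : ∀ d : ℕ, ∃ θ : ℝ, ∀ i, n₁ + d + D * i ≤ N →
      NearInt w (b (n₁ + d + D * i) * θ + v (n₁ + d + D * i)) := by
    intro d
    obtain ⟨θ, hθ⟩ := exists_forall_nearInt hw0 hw (b := fun i => b (n₁ + d + D * i))
      (fun i => v (n₁ + d + D * i)) (hb _ (by simp only [mul_zero]; omega)) ((N - (n₁ + d)) / D) (by
        intro i hi
        have h2 : D * (i + 1) ≤ N - (n₁ + d) := by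
          rw [mul_comm]; exact (Nat.le_div_iff_mul_le hD).1 hi
        have h1 : 0 < D * (i + 1) := by positivity
        have := hbn (n₁ + d + D * i) (by omega) (by rw [mul_add] at h1 h2; omega)
        rwa [add_assoc (n₁ + d), ← Nat.mul_succ] at this)
    refine ⟨θ, fun i hi => hθ i ?_⟩
    rw [Nat.le_div_iff_mul_le hD, mul_comm]
    omega
  choose θ hθ using key
  refine ⟨θ, fun n h1 h2 => ?_⟩
  have h3 : n₁ + (n - n₁) % D + D * ((n - n₁) / D) = n := by
    have := Nat.mod_add_div (n - n₁) D
    omega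
  have := hθ ((n - n₁) % D) ((n - n₁) / D) (by rw [h3]; exact h2)
  rwa [h3] at this

/-- Every vector of residues is served by its own window `(P j, P (j + 1)]`. -/
theorem exists_frequencies_windows {b : ℕ → ℝ} {D K : ℕ} (hD : 0 < D) (hK : 0 < K) {P : ℕ → ℕ}
    (hP : Monotone P) (hb : ∀ n, P 0 ≤ n → b n ≠ 0)
    (hbn : ∀ n, P 0 ≤ n → n + D ≤ P (K ^ D) → 2 * K * |b n| ≤ |b (n + D)|) :
    ∃ θ : ℕ → ℝ, ∀ c : ℕ → ℕ, (∀ d, c d < K) → ∃ j < K ^ D, ∀ n ∈ Finset.Ioc (P j) (P (j + 1)),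
      ∃ d < D, NearInt (1 / K) (b n * θ d + c d / K) := by
  have e : Fin (K ^ D) ≃ (Fin D → Fin K) := finFunctionFinEquiv.symm
  -- Window `j` is assigned the `j`-th vector of residues; the value 0 out of range is never used.
  -- Disjointness of the windows makes the target `v n` well defined.
  let q : ℕ → ℕ → ℕ := fun j d => if h : j < K ^ D ∧ d < D then (e ⟨j, h.1⟩ ⟨d, h.2⟩ : ℕ) else 0
  have hv : ∃ v : ℕ → ℝ, ∀ j, ∀ n ∈ Finset.Ioc (P j) (P (j + 1)),
      v n = (q j ((n - P 0) % D) : ℝ) / K := by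
    classical
    refine ⟨fun n => if h : ∃ j, n ∈ Finset.Ioc (P j) (P (j + 1)) then
      (q h.choose ((n - P 0) % D) : ℝ) / K else 0, fun j n hn => ?_⟩
    have h : ∃ j, n ∈ Finset.Ioc (P j) (P (j + 1)) := ⟨j, hn⟩
    have huniq : h.choose = j := by
      by_contra hne
      have hdisj := hP.pairwise_disjoint_on_Ioc_succ hne
      have h1 := h.choose_spec
      rw [Finset.mem_Ioc] at h1 hn
      exact Set.disjoint_left.1 hdisj h1 hn
    simp only [dif_pos h, huniq]
  obtain ⟨v, hv⟩ := hv
  have hK0 : (0 : ℝ) < K := by exact_mod_cast hK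
  obtain ⟨θ, hθ⟩ := exists_frequencies (w := 1 / K) (by positivity)
    (by rw [div_le_one hK0]; exact_mod_cast hK) v hD hb (N := P (K ^ D)) (by
      intro n h1 h2
      rw [one_div_mul_eq_div, le_div_iff₀ hK0]
      linarith [hbn n h1 h2])
  refine ⟨θ, fun c hc => ?_⟩
  let j := e.symm fun d => ⟨c d, hc d⟩
  refine ⟨j, j.2, fun n hn => ⟨(n - P 0) % D, Nat.mod_lt _ hD, ?_⟩⟩
  have hq : q j ((n - P 0) % D) = c ((n - P 0) % D) := by
    have h : (j : ℕ) < K ^ D ∧ (n - P 0) % D < D := ⟨j.2, Nat.mod_lt _ hD⟩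
    simp only [q, dif_pos h, j, Fin.eta, Equiv.apply_symm_apply]
  have h1 := hv j n hn
  rw [Finset.mem_Ioc] at hn
  have h0 : P 0 ≤ P j := hP (Nat.zero_le _)
  have h3 : P (j + 1) ≤ P (K ^ D) := hP j.2
  have := hθ n (by omega) (by omega)
  rwa [h1, hq] at this

/-- Averaging over shifts: for each `y` at most two `k < K` put `y + k / K` in `[0, 2 / K)` modulo
1. -/
theorem exists_shift_card_le (θ : ℝ) {K : ℕ} (hK : 0 < K) (H : ℕ) :
    ∃ k : ℕ, K * ((Finset.range H).filter fun i : ℕ =>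
      Int.fract ((i : ℝ) * θ + k / K) < 2 / K).card ≤ 2 * H := by
  have hK0 : (0 : ℝ) < K := by exact_mod_cast hK
  have key : ∀ y : ℝ, ((Finset.range K).filter fun k : ℕ =>
      Int.fract (y + k / K) < 2 / K).card ≤ 2 := by
    intro y
    refine (Finset.card_le_card (t := {(⌈-(K * y)⌉ % K).toNat, ((⌈-(K * y)⌉ + 1) % K).toNat})
      fun k hk => ?_).trans Finset.card_le_two
    rw [Finset.mem_filter, Finset.mem_range, lt_div_iff₀ hK0] at hk
    obtain ⟨hkK, hk⟩ := hk
    have h0 := Int.fract_nonneg (y + k / K)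
    set z := ⌊y + (k : ℝ) / K⌋ with hz
    have hfr : Int.fract (y + (k : ℝ) / K) * K = K * y + k - K * z := by
      rw [Int.fract, ← hz]; field_simp
    have h1 : 0 ≤ K * y + k - K * z := hfr ▸ mul_nonneg h0 hK0.le
    rw [hfr] at hk
    have h2 : ⌈-(K * y)⌉ ≤ (k : ℤ) - K * z := by
      rw [Int.ceil_le]; push_cast; linarith
    have h3 : (k : ℤ) - K * z < ⌈-(K * y)⌉ + 2 := by
      have := Int.le_ceil (-(K * y))
      have h : ((k : ℤ) - K * z : ℤ) < ((⌈-(K * y)⌉ + 2 : ℤ) : ℝ) := by push_cast; linarith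
      exact_mod_cast h
    have h4 : ((k : ℤ) - K * z) % K = k := by
      rw [Int.sub_mul_emod_self_left]
      exact Int.emod_eq_of_lt (by omega) (by omega)
    rw [Finset.mem_insert, Finset.mem_singleton]
    rcases (by omega : (k : ℤ) - K * z = ⌈-(K * y)⌉ ∨ (k : ℤ) - K * z = ⌈-(K * y)⌉ + 1) with h | h
    · left; rw [← h, h4]; simp
    · right; rw [← h, h4]; simp
  by_contra! hcon
  have h1 : ∑ k ∈ Finset.range K, ((Finset.range H).filter fun i : ℕ =>
      Int.fract ((i : ℝ) * θ + k / K) < 2 / K).card ≤ 2 * H := by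
    simp only [Finset.card_filter]
    rw [Finset.sum_comm]
    simp only [← Finset.card_filter]
    refine (Finset.sum_le_sum (s := Finset.range H) fun (i : ℕ) _ => key (i * θ : ℝ)).trans_eq ?_
    simp [mul_comm]
  have h2 : ∑ k ∈ Finset.range K, 2 * H < ∑ k ∈ Finset.range K,
      K * ((Finset.range H).filter fun i : ℕ => Int.fract ((i : ℝ) * θ + k / K) < 2 / K).card :=
    Finset.sum_lt_sum_of_nonempty (by simpa using hK.ne') fun k _ => hcon k
  rw [Finset.sum_const, Finset.card_range, smul_eq_mul, ← Finset.mul_sum] at h2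
  exact absurd (Nat.mul_le_mul_left K h1) h2.not_ge

/-- Given `i`, let `c d / K` be the fractional part of `i * θ d + k d / K` rounded down to a
multiple of `1 / K`. In the window serving `c`, the rounding error and the `NearInt` error, each at
most `1 / K`, add up to put `(i - a n) * θ d + k d / K` in `[0, 2 / K)` modulo 1. -/
theorem exists_integer_pattern {a : ℕ → ℤ} {D K : ℕ} (hK : 2 ≤ K) {θ : ℕ → ℝ} {P : ℕ → ℕ} {J : ℕ}
    (h : ∀ c : ℕ → ℕ, (∀ d, c d < K) → ∃ j < J, ∀ n ∈ Finset.Ioc (P j) (P (j + 1)),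
      ∃ d < D, NearInt (1 / K) (-(a n : ℝ) * θ d + c d / K)) (H : ℕ) :
    ∃ s : Finset ℕ, (∀ i ∈ s, i < H) ∧ K * s.card ≤ 2 * D * H ∧
      ∀ i : ℤ, ∃ j < J, ∀ n ∈ Finset.Ioc (P j) (P (j + 1)),
        0 ≤ i - a n → i - a n < H → (i - a n).toNat ∈ s := by
  classical
  have hK0 : (0 : ℝ) < K := by exact_mod_cast (by omega : 0 < K)
  have hk := fun d => exists_shift_card_le (θ d) (by omega : 0 < K) H
  choose k hk using hk
  refine ⟨(Finset.range D).biUnion fun d => (Finset.range H).filter fun i : ℕ =>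
      Int.fract ((i : ℝ) * θ d + k d / K) < 2 / K, ?_, ?_, ?_⟩
  · intro i hi
    simp only [Finset.mem_biUnion, Finset.mem_filter, Finset.mem_range] at hi
    obtain ⟨_, _, hi, _⟩ := hi
    exact hi
  · refine (Nat.mul_le_mul_left K Finset.card_biUnion_le).trans ?_
    rw [Finset.mul_sum]
    refine (Finset.sum_le_sum fun d _ => hk d).trans_eq ?_
    simp; ring
  · intro i
    let y : ℕ → ℝ := fun d => (i : ℝ) * θ d + k d / K
    have hfl : ∀ d, (⌊K * Int.fract (y d)⌋₊ : ℝ) ≤ K * Int.fract (y d) ∧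
        K * Int.fract (y d) < ⌊K * Int.fract (y d)⌋₊ + 1 := fun d =>
      ⟨Nat.floor_le (mul_nonneg hK0.le (Int.fract_nonneg _)), Nat.lt_floor_add_one _⟩
    obtain ⟨j, hj, hjn⟩ := h (fun d => ⌊K * Int.fract (y d)⌋₊) fun d => by
      have : (⌊K * Int.fract (y d)⌋₊ : ℝ) < K :=
        (hfl d).1.trans_lt (by nlinarith [Int.fract_lt_one (y d)])
      exact_mod_cast this
    refine ⟨j, hj, fun n hn h0 hH => ?_⟩
    obtain ⟨d, hd, z, hz1, hz2⟩ := hjn n hn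
    simp only [Finset.mem_biUnion, Finset.mem_filter, Finset.mem_range]
    refine ⟨d, hd, by omega, ?_⟩
    have hcast : (((i - a n).toNat : ℕ) : ℝ) = i - a n := by
      rw [← Int.cast_natCast, Int.toNat_of_nonneg h0]; push_cast; ring
    rw [hcast]
    obtain ⟨hf1, hf2⟩ := hfl d
    set c : ℝ := (⌊K * Int.fract (y d)⌋₊ : ℝ)
    have hf1' : c / K ≤ Int.fract (y d) := by rw [div_le_iff₀ hK0]; linarith
    have hf2' : Int.fract (y d) < c / K + 1 / K := by rw [← add_div, lt_div_iff₀ hK0]; linarith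
    have hy : ((i : ℝ) - a n) * θ d + k d / K = y d - a n * θ d := by simp only [y]; ring
    have hyf := Int.floor_add_fract (y d)
    have h2K : 2 / (K : ℝ) = 1 / K + 1 / K := by ring
    have h2K1 : 2 / (K : ℝ) ≤ 1 := by rw [div_le_one hK0]; exact_mod_cast hK
    have hfloor : ⌊((i : ℝ) - a n) * θ d + k d / K⌋ = ⌊y d⌋ + z := by
      rw [Int.floor_eq_iff]
      push_cast
      constructor <;> linarith
    rw [Int.fract, hfloor, hy]
    push_cast
    linarith

end Diophantine

/-! ### Choosing the parameters from the growth condition -/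

section Growth

theorem pow_mul_abs_le {b : ℕ → ℝ} {q : ℝ} (hq : 0 ≤ q) {n₁ N : ℕ}
    (h : ∀ n, n₁ ≤ n → n < N → q * |b n| ≤ |b (n + 1)|) {n : ℕ} (hn : n₁ ≤ n) (k : ℕ)
    (hk : n + k ≤ N) : q ^ k * |b n| ≤ |b (n + k)| := by
  induction k with
  | zero => simp
  | succ k ih =>
    calc q ^ (k + 1) * |b n| = q * (q ^ k * |b n|) := by ring
      _ ≤ q * |b (n + k)| := by gcongr; exact ih (by omega)
      _ ≤ _ := h (n + k) (by omega) (by omega)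

theorem two_pow_le_one_add_inv_pow {l : ℕ} (hl : 0 < l) (s : ℕ) :
    (2 : ℝ) ^ s ≤ (1 + 1 / l) ^ (l * s) := by
  rw [pow_mul]
  refine pow_le_pow_left₀ (by norm_num) ?_ s
  have hl0 : (0 : ℝ) < l := by exact_mod_cast hl
  have := one_add_mul_le_pow (a := (1 / l : ℝ)) (by have : (0 : ℝ) < 1 / l := by positivity
                                                    linarith) l
  rw [mul_one_div_cancel hl0.ne'] at this
  linarith

/-- Since `p < 1`, the base `2 ^ p⁻¹` exceeds 2, so its `t`-th power beats `t ^ 2 * 2 ^ t`. -/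
theorem exists_exponent {p : ℝ} (hp0 : 0 < p) (hp1 : p < 1) {C δ : ℝ} (hC : 0 ≤ C) (hδ : 0 < δ) :
    ∃ t : ℕ, 1 ≤ t ∧ 2 * (2 ^ t * (2 * t + 1)) ≤ δ * 4 ^ t ∧
      (2 * t * (2 ^ t * (2 * t + 1)) + C) ^ p ≤ (2 : ℝ) ^ t := by
  set g : ℝ := 2 ^ p⁻¹ with hg
  have hg2 : 1 < g / 2 := by
    rw [one_lt_div two_pos, hg]
    exact Real.self_lt_rpow_of_one_lt one_lt_two ((one_lt_inv₀ hp0).2 hp1)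
  have h1 := (tendsto_pow_const_div_const_pow_of_one_lt 1 (one_lt_two (α := ℝ))).eventually
    (ge_mem_nhds (by positivity : 0 < δ / 6))
  have h2 := (tendsto_pow_const_div_const_pow_of_one_lt 2 hg2).eventually
    (ge_mem_nhds (by positivity : 0 < 1 / (6 + C)))
  obtain ⟨t, ⟨ht1, ht2⟩, ht⟩ := ((h1.and h2).and (eventually_ge_atTop 1)).exists
  have ht' : (1 : ℝ) ≤ t := by exact_mod_cast ht
  have h2t : (1 : ℝ) ≤ 2 ^ t := one_le_pow₀ one_le_two
  refine ⟨t, ht, ?_, ?_⟩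
  · rw [pow_one, div_le_iff₀ (by positivity)] at ht1
    rw [show (4 : ℝ) = 2 * 2 by norm_num, mul_pow]
    nlinarith
  · rw [div_le_iff₀ (by positivity), one_div_mul_eq_div, le_div_iff₀ (by positivity)] at ht2
    have hle : 2 * t * (2 ^ t * (2 * t + 1)) + C ≤ ((2 : ℝ) ^ t) ^ p⁻¹ := by
      have : ((2 : ℝ) ^ t) ^ p⁻¹ = 2 ^ t * (g / 2) ^ t := by
        rw [← mul_pow, mul_div_cancel₀ _ two_ne_zero, hg, ← Real.rpow_natCast, ← Real.rpow_natCast,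
          ← Real.rpow_mul zero_le_two, ← Real.rpow_mul zero_le_two, mul_comm]
      rw [this]
      calc 2 * t * (2 ^ t * (2 * t + 1)) + C ≤ 2 ^ t * (t ^ 2 * (6 + C)) := by
            have e1 : 2 * (t : ℝ) * (2 * t + 1) ≤ 6 * t ^ 2 := by nlinarith
            have e2 : C ≤ 2 ^ t * (t ^ 2 * C) :=
              calc C = 1 * (1 * C) := by ring
                _ ≤ _ := by gcongr; exact one_le_pow₀ ht'
            nlinarith
        _ ≤ _ := by gcongr
    calc _ ≤ (((2 : ℝ) ^ t) ^ p⁻¹) ^ p := Real.rpow_le_rpow (by positivity) hle hp0.le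
      _ = _ := Real.rpow_inv_rpow (by positivity) hp0.ne'

/-- Under the growth condition there are `D` frequencies and a chain of log-windows that serve all
vectors of `D` residues modulo `K`, with `D / K` as small as desired. -/
theorem exists_log_windows {a : ℕ → ℤ} {η : ℝ} (hη : 0 < η)
    (ha : ∀ᶠ n : ℕ in atTop, (a (n + 1) : ℝ) / (a n : ℝ) ≥
        1 + 1 / (Real.log (Real.log (Real.log (n : ℝ)))) ^ (1 - η))
    {δ : ℝ} (hδ : 0 < δ) (m : ℕ) :
    ∃ (D K J : ℕ) (θ : ℕ → ℝ) (P : ℕ → ℕ), 2 ≤ K ∧ 2 * (D : ℝ) ≤ δ * K ∧ Monotone P ∧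
      (∀ j, m ≤ P j) ∧ (∀ j, IsLogWindow δ (P j) (P (j + 1))) ∧
      ∀ c : ℕ → ℕ, (∀ d, c d < K) → ∃ j < J, ∀ n ∈ Finset.Ioc (P j) (P (j + 1)),
        ∃ d < D, NearInt (1 / K) (-(a n : ℝ) * θ d + c d / K) := by
  -- The maximum keeps the exponent positive when `η ≥ 1`.
  set p : ℝ := max (1 - η) (1 / 2) with hp
  have hp0 : 0 < p := lt_max_of_lt_right (by norm_num)
  have hp1 : p < 1 := max_lt (by linarith) (by norm_num)
  have hlog := Real.tendsto_log_atTop.comp (tendsto_natCast_atTop_atTop (R := ℝ))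
  have hlog2 := Real.tendsto_log_atTop.comp hlog
  have hlog3 := Real.tendsto_log_atTop.comp hlog2
  obtain ⟨n₁, hn₁⟩ := eventually_atTop.1 (ha.and ((hlog.eventually_ge_atTop 1).and
    ((hlog2.eventually_ge_atTop 1).and ((hlog3.eventually_ge_atTop 1).and
      (eventually_ge_atTop (max m 2))))))
  simp only [Function.comp_apply] at hn₁
  obtain ⟨-, h1log, h1log2, -, hmn₁⟩ := hn₁ n₁ le_rfl
  have hmn : m ≤ n₁ := (le_max_left _ _).trans hmn₁
  have h2n : 2 ≤ n₁ := (le_max_right _ _).trans hmn₁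
  set Q : ℕ := max 2 ⌈1 / δ⌉₊ with hQ
  have hQ2 : 2 ≤ Q := le_max_left _ _
  have hQδ : 1 ≤ δ * Q := by
    have : 1 / δ ≤ Q := (Nat.le_ceil _).trans (by exact_mod_cast le_max_right _ _)
    rwa [div_le_iff₀' hδ] at this
  obtain ⟨t, ht1, htδ, htp⟩ := exists_exponent hp0 hp1
    (abs_nonneg (Real.log (Real.log Q + Real.log (Real.log n₁)))) hδ
  set C : ℝ := |Real.log (Real.log Q + Real.log (Real.log n₁))| with hC
  set D : ℕ := 2 ^ t * (2 * t + 1) with hD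
  set K : ℕ := 4 ^ t with hK
  let P : ℕ → ℕ := fun j => n₁ ^ Q ^ j
  have hP : Monotone P := fun i j hij =>
    Nat.pow_le_pow_right (by omega) (Nat.pow_le_pow_right (by omega) hij)
  have hP0 : P 0 = n₁ := by simp [P]
  have hlogP : ∀ j, Real.log (P j) = Q ^ j * Real.log n₁ := fun j => by
    simp only [P]
    push_cast
    rw [Real.log_pow]
    push_cast
    rfl
  have hD0 : 0 < D := by positivity
  have hK0 : 0 < K := by positivity
  have hQlog : 0 ≤ Real.log Q := Real.log_natCast_nonneg Q
  have hN : Real.log (Real.log (Real.log (P (K ^ D)))) ≤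
      2 * t * (2 ^ t * (2 * t + 1)) + C := by
    have hKD : (1 : ℝ) ≤ (K : ℝ) ^ D := one_le_pow₀ (by exact_mod_cast hK0)
    have e1 : Real.log (Real.log (P (K ^ D))) =
        (K : ℝ) ^ D * Real.log Q + Real.log (Real.log n₁) := by
      rw [hlogP, Real.log_mul (by positivity) (by linarith), Real.log_pow]
      push_cast
      rfl
    have e2 : Real.log (Real.log (P (K ^ D))) ≤
        (K : ℝ) ^ D * (Real.log Q + Real.log (Real.log n₁)) := by
      rw [e1]; nlinarith
    have e3 : Real.log ((K : ℝ) ^ D) ≤ 2 * t * (2 ^ t * (2 * t + 1)) := by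
      have h4 : Real.log 4 ≤ 2 := by
        rw [show (4 : ℝ) = 2 ^ 2 by norm_num, Real.log_pow]
        have := Real.log_two_lt_d9
        push_cast
        linarith
      rw [Real.log_pow, hK, hD]
      push_cast
      rw [Real.log_pow]
      calc (2 ^ t * (2 * (t : ℝ) + 1)) * (t * Real.log 4) ≤
            (2 ^ t * (2 * (t : ℝ) + 1)) * (t * 2) := by gcongr
        _ = _ := by ring
    refine (Real.log_le_log ?_ e2).trans ?_
    · rw [e1]; nlinarith
    · rw [Real.log_mul (by positivity) (by linarith)]
      exact add_le_add e3 (le_abs_self _)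
  have hratio : ∀ n, n₁ ≤ n → (a n : ℝ) ≠ 0 := by
    intro n hn h0
    obtain ⟨h1, -, -, h2, -⟩ := hn₁ n hn
    rw [h0, div_zero] at h1
    have : 0 ≤ 1 / (Real.log (Real.log (Real.log (n : ℝ)))) ^ (1 - η) := by positivity
    linarith
  have hstep : ∀ n, n₁ ≤ n → n < P (K ^ D) →
      (1 + 1 / ((2 ^ t : ℕ) : ℝ)) * |(-(a n : ℝ))| ≤ |(-(a (n + 1) : ℝ))| := by
    intro n hn hnN
    obtain ⟨h1, hl1, hl2, hl3, -⟩ := hn₁ n hn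
    have hle : Real.log (Real.log (Real.log n)) ≤ Real.log (Real.log (Real.log (P (K ^ D)))) := by
      have hn0 : (0 : ℝ) < n := by exact_mod_cast (by omega : 0 < n)
      exact Real.log_le_log (by linarith) (Real.log_le_log (by linarith)
        (Real.log_le_log hn0 (by exact_mod_cast hnN.le)))
    have hpow : (Real.log (Real.log (Real.log n))) ^ (1 - η) ≤ 2 ^ t :=
      calc (Real.log (Real.log (Real.log n))) ^ (1 - η)
          ≤ (Real.log (Real.log (Real.log n))) ^ p :=
            Real.rpow_le_rpow_of_exponent_le hl3 (le_max_left _ _)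
        _ ≤ (2 * t * (2 ^ t * (2 * t + 1)) + C) ^ p :=
            Real.rpow_le_rpow (by linarith) (hle.trans hN) hp0.le
        _ ≤ 2 ^ t := htp
    have hpos : 0 < (Real.log (Real.log (Real.log n))) ^ (1 - η) :=
      Real.rpow_pos_of_pos (by linarith) _
    have h2 : 1 + 1 / ((2 ^ t : ℕ) : ℝ) ≤ (a (n + 1) : ℝ) / (a n : ℝ) := by
      push_cast
      refine le_trans ?_ h1
      gcongr
    rw [abs_neg, abs_neg]
    have h3 := h2.trans (le_abs_self _)
    rwa [abs_div, le_div_iff₀ (abs_pos.2 (hratio n hn))] at h3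
  -- By Bernoulli, `2 ^ t` steps at least double `|a n|`, so `D` steps gain `2 ^ (2 * t + 1) = 2 *
  -- K`.
  obtain ⟨θ, hθ⟩ := exists_frequencies_windows (b := fun n => -(a n : ℝ)) hD0 hK0 hP
    (fun n hn => neg_ne_zero.2 (hratio n (hP0 ▸ hn))) (by
      intro n hn hnN
      refine le_trans ?_ (pow_mul_abs_le (by positivity) hstep (hP0 ▸ hn) D hnN)
      refine mul_le_mul_of_nonneg_right ?_ (abs_nonneg _)
      refine le_of_eq_of_le ?_ (two_pow_le_one_add_inv_pow (by positivity) (2 * t + 1))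
      rw [hK, pow_succ, pow_mul]
      push_cast
      norm_num [mul_comm])
  refine ⟨D, K, K ^ D, θ, P, ?_, ?_, hP, fun j => ?_, fun j => ?_, hθ⟩
  · calc 2 ≤ 4 ^ 1 := by norm_num
      _ ≤ 4 ^ t := Nat.pow_le_pow_right (by norm_num) ht1
  · rw [hD, hK]
    push_cast
    exact htδ
  · exact hmn.trans (hP0 ▸ hP (Nat.zero_le j))
  · rw [IsLogWindow, hlogP, hlogP, pow_succ]
    have : 0 ≤ (Q : ℝ) ^ j * Real.log n₁ := by positivity
    nlinarith

end Growth

/-! ### Transfer to the measure space -/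

section Transfer

variable {X : Type*} [MeasurableSpace X] {μ : Measure X}

theorem measurePreserving_zpow {T : X ≃ᵐ X} (hT : MeasurePreserving T μ μ) (k : ℤ) :
    MeasurePreserving (fun x => ((T.toEquiv : Equiv.Perm X) ^ k) x) μ μ := by
  obtain ⟨n, rfl | rfl⟩ := k.eq_nat_or_neg
  · simp only [zpow_natCast, ← Equiv.Perm.iterate_eq_pow]
    exact hT.iterate n
  · simp only [zpow_neg, zpow_natCast, ← inv_pow, ← Equiv.Perm.iterate_eq_pow]
    exact (hT.symm T).iterate n

variable [IsProbabilityMeasure μ] {T : X → X}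

/-- A point on level `i` of the tower is sent by `S n` to level `i - a n`, so the levels indexed by
the integer pattern form `F`. Hypothesis `hST` covers invertible and non-invertible `T` at once. -/
theorem IsAperiodic.sweepsOut (hap : IsAperiodic μ T) (hT : MeasurePreserving T μ μ) {a : ℕ → ℤ}
    {η : ℝ} (hη : 0 < η)
    (ha : ∀ᶠ n : ℕ in atTop, (a (n + 1) : ℝ) / (a n : ℝ) ≥
        1 + 1 / (Real.log (Real.log (Real.log (n : ℝ)))) ^ (1 - η))
    {S : ℕ → X → X} (hS : ∀ n, 1 ≤ n → MeasurePreserving (S n) μ μ)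
    (hST : ∀ n, 1 ≤ n → ∀ (x : X) (i : ℕ), 0 ≤ (i : ℤ) - a n →
      T^[((i : ℤ) - a n).toNat] (S n x) = T^[i] x) :
    SweepsOut μ S := by
  classical
  refine sweepsOut_of_windows hS fun δ hδ m => ?_
  obtain ⟨D, K, J, θ, P, hK, hDK, hP, hmP, hwin, hc⟩ := exists_log_windows hη ha hδ m
  set R : ℕ := (Finset.range (P J + 1)).sup fun n => (a n).natAbs
  have hR : ∀ n ≤ P J, (a n).natAbs ≤ R := fun n hn =>
    Finset.le_sup (f := fun n => (a n).natAbs) (Finset.mem_range.2 (Nat.lt_succ_of_le hn))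
  set H : ℕ := ⌈4 * R / δ⌉₊ + 1 with hH
  have hRH : (2 * R : ℕ) ≤ δ / 2 * H := by
    have : 4 * R / δ ≤ H := (Nat.le_ceil _).trans (by rw [hH]; push_cast; linarith)
    rw [div_le_iff₀ hδ] at this
    push_cast
    linarith
  have hK0 : (0 : ℝ) < K := by exact_mod_cast (by omega : 0 < K)
  obtain ⟨B, hB, hBdisj, hBcompl⟩ := hap.exists_rokhlin_tower hT (n := H) (by omega)
    (ENNReal.ofReal_pos.2 (half_pos hδ)).ne'
  have hHB : (H : ℝ≥0∞) * μ B ≤ 1 := by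
    have := measure_biUnion_preimage_iterate hT hB hBdisj (Finset.range H) (by simp)
    rw [Finset.card_range] at this
    rw [← this]
    exact prob_le_one
  have hlevels : ∀ (r : ℝ) (s : Finset ℕ), 0 ≤ r → (∀ i ∈ s, i < H) → (s.card : ℝ) ≤ r * H →
      μ (⋃ i ∈ s, T^[i] ⁻¹' B) ≤ ENNReal.ofReal r := by
    intro r s hr hs hcard
    rw [measure_biUnion_preimage_iterate hT hB hBdisj s hs]
    have h1 : (s.card : ℝ≥0∞) ≤ ENNReal.ofReal r * H := by
      rw [← ENNReal.ofReal_natCast, ← ENNReal.ofReal_natCast, ← ENNReal.ofReal_mul hr]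
      exact ENNReal.ofReal_le_ofReal hcard
    calc (s.card : ℝ≥0∞) * μ B ≤ (ENNReal.ofReal r * H) * μ B := by gcongr
      _ = ENNReal.ofReal r * (H * μ B) := mul_assoc _ _ _
      _ ≤ ENNReal.ofReal r * 1 := by gcongr
      _ = _ := mul_one _
  obtain ⟨s, hs, hscard, hsJ⟩ := exists_integer_pattern hK hc H
  refine ⟨P J, ⋃ i ∈ s, T^[i] ⁻¹' B,
    Finset.measurableSet_biUnion _ fun i _ => (hT.iterate i).measurable hB,
    hlevels δ s hδ.le hs ?_, ?_⟩
  · have h1 : (K : ℝ) * s.card ≤ 2 * D * H := by exact_mod_cast hscard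
    refine le_of_mul_le_mul_left (h1.trans ?_) hK0
    calc 2 * (D : ℝ) * H ≤ δ * K * H := by gcongr
      _ = K * (δ * H) := by ring
  -- Levels within `R` of either end, from which `i - a n` might leave the tower. The choice of `H`
  -- bounds their measure by `δ / 2`.
  · set s' : Finset ℕ := (Finset.range H).filter fun i => i < R ∨ H ≤ i + R with hs'
    have hs'card : s'.card ≤ 2 * R := by
      have hsub : s' ⊆ Finset.range R ∪ Finset.Ico (H - R) H := by
        intro i hi
        simp only [hs', Finset.mem_filter, Finset.mem_range, Finset.mem_union,
          Finset.mem_Ico] at hi ⊢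
        omega
      refine (Finset.card_le_card hsub).trans ((Finset.card_union_le _ _).trans ?_)
      rw [Finset.card_range, Nat.card_Ico]
      omega
    have hμs' := hlevels (δ / 2) s' (half_pos hδ).le (by simp +contextual [hs'])
      (le_trans (by exact_mod_cast hs'card) hRH)
    refine le_trans (measure_mono ?_) ((measure_union_le
      (⋃ i ∈ Finset.range H, T^[i] ⁻¹' B)ᶜ (⋃ i ∈ s', T^[i] ⁻¹' B)).trans
      ((add_le_add hBcompl hμs').trans_eq ?_))
    · intro x hx
      by_contra hcon
      rw [Set.mem_union, not_or, Set.notMem_compl_iff] at hcon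
      simp only [Set.mem_iUnion, Set.mem_preimage, Finset.mem_range, not_exists] at hcon
      obtain ⟨⟨i, hiH, hi⟩, hx'⟩ := hcon
      have his' : R ≤ i ∧ i + R < H := by
        by_contra h
        exact hx' i (Finset.mem_filter.2 ⟨Finset.mem_range.2 hiH, by omega⟩) hi
      obtain ⟨j, hj, hjn⟩ := hsJ i
      refine hx ⟨P j, P (j + 1), hmP _, hP hj, hwin j, fun n hn => ?_⟩
      have hnJ : n ≤ P J := (Finset.mem_Ioc.1 hn).2.trans (hP hj)
      have hn1 : 1 ≤ n := by have := (Finset.mem_Ioc.1 hn).1; omega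
      have han := hR n hnJ
      have h0 : 0 ≤ (i : ℤ) - a n := by omega
      refine Set.mem_iUnion₂.2 ⟨_, hjn n hn h0 (by omega), ?_⟩
      rw [Set.mem_preimage, hST n hn1 x i h0]
      exact hi
    · rw [← ENNReal.ofReal_add (half_pos hδ).le (half_pos hδ).le, add_halves]

end Transfer

end LogSweep

theorem corollary1 (a : ℕ → ℤ) (η : ℝ) (hη : 0 < η)
    (ha : ∀ᶠ n : ℕ in Filter.atTop,
      (a (n + 1) : ℝ) / (a n : ℝ) ≥
        1 + 1 / (Real.log (Real.log (Real.log (n : ℝ)))) ^ (1 - η)) :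
    LogSweep.StrongSweepingOut.{u} a := by
  refine ⟨fun X _ μ _ T hT hap => hap.sweepsOut hT hη ha
    (fun n _ => LogSweep.measurePreserving_zpow hT _) fun n _ x i h => ?_,
    fun hpos X _ μ _ T hT hap => hap.sweepsOut hT hη ha
    (fun n _ => hT.iterate _) fun n hn x i h => ?_⟩
  · have hiter : ∀ (k : ℕ) (y : X), T^[k] y = ((T.toEquiv : Equiv.Perm X) ^ (k : ℤ)) y :=
      fun k y => by rw [zpow_natCast, ← Equiv.Perm.iterate_eq_pow]; rfl
    rw [hiter, hiter, ← Equiv.Perm.mul_apply, ← zpow_add, Int.toNat_of_nonneg h, sub_add_cancel]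
  · have := hpos n hn
    rw [← Function.iterate_add_apply]
    congr 2
    omega
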